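/- Let $-1<q<1$ and $t>0$. Write $[n]_q=\sum_{j=0}^{n-1}q^j$ and $[n]_q!=\prod_{j=1}^n[j]_q$. Let $C_{q,m}(x,t)$, $m\ge 0$, be the scaled centered continuous big $q$-Hermite polynomials in $x$, defined by $C_{q,0}=1$, $C_{q,1}=x$ and $$x\,C_{q,m}(x,t)=C_{q,m+1}(x,t)+[m]_q\,C_{q,m}(x,t)+t\,[m]_q\,C_{q,m-1}(x,t)\qquad(m\ge 1).$$ These polynomials have a measure of orthogonality, that is, a probability measure on $\mathbb R$ with finite moments of all orders with respect to which $C_{q,m}(\cdot,t)$ and $C_{q,n}(\cdot,t)$ are orthogonal whenever $m\ne n$. Write $\langle f\rangle=\int f\,d\mu$, where $\mu$ is any such measure. For non-negative integers $n_1,\dots,n_k$ (with $k \ge 0$) put $n=n_1+\dots+n_k$, and let $\mathcal P(n_1,\dots,n_k)$ be the set of all set partitions $\pi$ of $\{1,\dots,n\}$ that are inhomogeneous: when $\{1,\dots,n\}$ is cut into consecutive intervals of lengths $n_1,\dots,n_k$, no class of $\pi$ contains two distinct elements of the same interval. For a set partition $\pi$, let $|\pi|$ be its number of classes, $s(\pi)$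 its number of one-element classes, and $\mathrm{rc}(\pi)$ the number of its restricted crossings, that is, of quadruples $i<j<k<l$ such that $k$ is the smallest element larger than $i$ in the class of $i$ and $l$ is the smallest element larger than $j$ in the class of $j$. Then, with the convention $0^0=1$, $$\Big\langle\prod_{j=1}^k C_{q,n_j}(x,t)\Big\rangle=\sum_{\substack{\pi\in\mathcal P(n_1,\dots,n_k)\\ s(\pi)=0}}q^{\mathrm{rc}(\pi)}\,t^{|\pi|},$$ and, as polynomials in $x$, $$\prod_{j=1}^k C_{q,n_j}(x,t)=\sum_{m=0}^n\Big(\frac1{[m]_q!}\sum_{\substack{\pi\in\mathcal P(n_1,\dots,n_k,m)\\ s(\pi)=0}}q^{\mathrm{rc}(\pi)}\,t^{|\pi|-m}\Big)\,C_{q,m}(x,t).$$ -/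

import Mathlib

open Polynomial MeasureTheory

namespace BigQHermite

/-- The `q`-integer `[n]_q = 1 + q + ⋯ + q^(n-1)`. -/
noncomputable def qInt (q : ℝ) (n : ℕ) : ℝ := ∑ j ∈ Finset.range n, q ^ j

/-- The `q`-factorial `[n]_q! = [1]_q [2]_q ⋯ [n]_q`. -/
noncomputable def qFact (q : ℝ) (n : ℕ) : ℝ := ∏ j ∈ Finset.Icc 1 n, qInt q j

/-- The scaled centered continuous big `q`-Hermite polynomials `C_{q,m}(x,t)`, as polynomials in
`x`: `C_{q,0} = 1`, `C_{q,1} = x` and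
`x C_{q,m} = C_{q,m+1} + [m]_q C_{q,m} + t [m]_q C_{q,m-1}` for `m ≥ 1`
(the relation for `m = 0` reads `x C_{q,0} = C_{q,1}`). -/
noncomputable def bigQHermite (q t : ℝ) : ℕ → ℝ[X]
  | 0 => 1
  | 1 => X
  | m + 2 => (X - C (qInt q (m + 1))) * bigQHermite q t (m + 1)
      - C (t * qInt q (m + 1)) * bigQHermite q t m

/-- `μ` is a measure of orthogonality of the polynomials `C_{q,m}(x,t)`: a probability measure on
`ℝ` with finite moments of all orders with respect to which they are pairwise orthogonal. -/
structure IsOrthogonalityMeasure (q t : ℝ) (μ : Measure ℝ) : Prop where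
  isProbabilityMeasure : IsProbabilityMeasure μ
  integrable_eval : ∀ p : ℝ[X], Integrable (fun x => p.eval x) μ
  orthogonal : ∀ m n : ℕ, m ≠ n →
    ∫ x, (bigQHermite q t m).eval x * (bigQHermite q t n).eval x ∂μ = 0

/-- Set partitions of `{0, …, n-1}` (with nonempty classes). -/
abbrev SetPartition (n : ℕ) := Finpartition (Finset.univ : Finset (Fin n))

/-- Position `i` belongs to the block with this index when `0, 1, 2, …` is cut into consecutive
intervals of lengths `n_1, n_2, …, n_k`. Blocks may be empty, and are numbered from `0`. -/
def blockIndex : List ℕ → ℕ → ℕ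
  | [], _ => 0
  | n :: ns, i => if i < n then 0 else blockIndex ns (i - n) + 1

/-- `π` is inhomogeneous with respect to the consecutive blocks of lengths `n_1, …, n_k`: no class
of `π` contains two distinct elements of the same block. -/
def Inhomogeneous (ns : List ℕ) (π : SetPartition ns.sum) : Prop :=
  ∀ B ∈ π.parts, ∀ i ∈ B, ∀ j ∈ B, i ≠ j → blockIndex ns i ≠ blockIndex ns j

/-- The number `s(π)` of singleton classes of `π`. -/
def numSingletons {n : ℕ} (π : SetPartition n) : ℕ :=
  (π.parts.filter fun B => B.card = 1).card

/-- `k` is the smallest element larger than `i` in the class of `i`. -/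
def IsNext {n : ℕ} (π : SetPartition n) (i k : Fin n) : Prop :=
  IsLeast {r : Fin n | i < r ∧ ∃ B ∈ π.parts, i ∈ B ∧ r ∈ B} k

/-- The number `rc(π)` of restricted crossings of `π`: quadruples `i < j < k < l` such that `k` is
the next element after `i` in its class and `l` is the next element after `j` in its class. -/
noncomputable def restrictedCrossings {n : ℕ} (π : SetPartition n) : ℕ :=
  Set.ncard {x : Fin n × Fin n × Fin n × Fin n |
    x.1 < x.2.1 ∧ x.2.1 < x.2.2.1 ∧ x.2.2.1 < x.2.2.2 ∧
      IsNext π x.1 x.2.2.1 ∧ IsNext π x.2.1 x.2.2.2}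

open Classical in
/-- The partitions in `𝒫(n_1, …, n_k)` (those inhomogeneous with respect to the blocks of lengths
`n_1, …, n_k`) with no singleton classes. -/
noncomputable def inhomogeneousNoSingletons (ns : List ℕ) : Finset (SetPartition ns.sum) :=
  Finset.univ.filter fun π => Inhomogeneous ns π ∧ numSingletons π = 0

end BigQHermite

namespace BigQHermite

/-! Both formulas compare polynomials in one Jacobi operator with a transfer-matrix count of
partitions.

Replace a partition by its arcs, each joining a point to the next one of its class. Scanning from
left to right with `h` arcs open, a point opens an arc (weight `t`, a new class), closes one, or
closes one and opens another. Closing an arc crosses the open arcs that started after it, so the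
choices sum to `[h]_q`. Without blocks, one point thus acts by `jacobi`.

Inside a block only the `a` arcs opened before it may be closed, and each of these crosses the `c`
arcs opened in it: this is `blockStep`. The q-commutation relation `blockStep_mul_innerStep` makes
the operator of a block of `m` points satisfy the recurrence of `C_{q,m}`, so that it equals
`C_{q,m}(J)` with `J = jacobi q t` (`blockOp_eq_aeval`). By `sum_inhomogeneousNoSingletons` the
generating function is therefore the entry at `0` of `∏ C_{q,n_j}(J)` applied to the vacuum.

On the other hand `C_{q,m}(J)` sends the vacuum to `[m]_q!` times the `m`-th basis vector. The entry
at `0` of `p(J)` on the vacuum is then the integral of `p` (`integral_eval_eq`), and the entry at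
`m` divided by `[m]_q!` is its coefficient on `C_{q,m}` (`eq_sum_bigQHermite`). As polynomials in
`J` commute, an additional last block can be moved to the front, where its `m` points must all open
arcs; it contributes `t^m` and selects the entry at `m` (`transfer_append_singleton`).

An orthogonality measure exists because the recurrence coefficients are bounded: it is the spectral
measure of a bounded self-adjoint Jacobi matrix. -/

@[simp] lemma qInt_zero (q : ℝ) : qInt q 0 = 0 := by simp [qInt]

@[simp] lemma qInt_one (q : ℝ) : qInt q 1 = 1 := by simp [qInt]

lemma qInt_succ (q : ℝ) (n : ℕ) : qInt q (n + 1) = 1 + q * qInt q n := by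
  simp only [qInt, Finset.sum_range_succ', Finset.mul_sum, pow_succ']
  simp [add_comm]

lemma qInt_succ' (q : ℝ) (n : ℕ) : qInt q (n + 1) = qInt q n + q ^ n := by
  simp [qInt, Finset.sum_range_succ]

lemma qInt_add (q : ℝ) (a c : ℕ) : qInt q (a + c) = q ^ c * qInt q a + qInt q c := by
  induction a with
  | zero => simp
  | succ a ih =>
    rw [show a + 1 + c = (a + c) + 1 by ring, qInt_succ', qInt_succ', ih]
    ring

lemma qFact_succ (q : ℝ) (n : ℕ) : qFact q (n + 1) = qFact q n * qInt q (n + 1) := by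
  simp [qFact, Finset.prod_Icc_succ_top]

lemma qInt_nonneg {q : ℝ} (hq : -1 < q) (hq1 : q < 1) (n : ℕ) : 0 ≤ qInt q n := by
  have h : qInt q n * (1 - q) = 1 - q ^ n := geom_sum_mul_neg q n
  have h1 : q ^ n ≤ 1 := le_trans (le_abs_self _) (by
    rw [abs_pow]; exact pow_le_one₀ (abs_nonneg _) (abs_le.2 ⟨hq.le, hq1.le⟩))
  by_contra! hneg
  nlinarith

lemma qInt_succ_pos {q : ℝ} (hq : -1 < q) (hq1 : q < 1) (n : ℕ) : 0 < qInt q (n + 1) := by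
  have h0 := qInt_nonneg hq hq1 n
  have h1 : qInt q n * (1 - q) = 1 - q ^ n := geom_sum_mul_neg q n
  have h2 := qInt_nonneg hq hq1 (n + 1)
  refine lt_of_le_of_ne h2 fun h => ?_
  have h3 : qInt q (n + 1) * (1 - q) = 1 - q ^ (n + 1) := geom_sum_mul_neg q (n + 1)
  have h4 : q ^ (n + 1) < 1 := lt_of_le_of_lt (le_abs_self _) (by
    rw [abs_pow]; exact pow_lt_one₀ (abs_nonneg _) (abs_lt.2 ⟨hq, hq1⟩) (by simp))
  rw [← h] at h3
  linarith

lemma qInt_le {q : ℝ} (hq : -1 < q) (hq1 : q < 1) (n : ℕ) : qInt q n ≤ 2 / (1 - q) := by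
  have h : qInt q n * (1 - q) = 1 - q ^ n := geom_sum_mul_neg q n
  have h1 : -1 ≤ q ^ n := le_trans (by
    rw [neg_le_neg_iff, abs_pow]; exact pow_le_one₀ (abs_nonneg _) (abs_le.2 ⟨hq.le, hq1.le⟩))
    (neg_abs_le _)
  rw [le_div_iff₀ (by linarith)]
  linarith

lemma qFact_pos {q : ℝ} (hq : -1 < q) (hq1 : q < 1) (n : ℕ) : 0 < qFact q n := by
  induction n with
  | zero => simp [qFact]
  | succ n ih => rw [qFact_succ]; exact mul_pos ih (qInt_succ_pos hq hq1 n)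

lemma bigQHermite_succ (q t : ℝ) (n : ℕ) :
    bigQHermite q t (n + 1) = (X - C (qInt q n)) * bigQHermite q t n
      - C (t * qInt q n) * bigQHermite q t (n - 1) := by
  cases n with
  | zero => simp [bigQHermite]
  | succ n => rfl

/-! ### Transfer operators of blocks as polynomials in the Jacobi operator -/

/-- The transposed Jacobi operator of the polynomials `bigQHermite q t`. -/
noncomputable def jacobi (q t : ℝ) : Module.End ℝ (ℕ → ℝ) where
  toFun f h := t * f (h + 1) + qInt q h * (f (h - 1) + f h)
  map_add' f g := by ext h; simp only [Pi.add_apply]; ring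
  map_smul' r f := by ext h; simp only [Pi.smul_apply, smul_eq_mul, RingHom.id_apply]; ring

/-- One step of the transfer matrix inside a block, on functions of the number `a` of arcs opened
before the block and the number `c` of arcs opened in it. -/
noncomputable def blockStep (q t : ℝ) : Module.End ℝ (ℕ → ℕ → ℝ) where
  toFun g a c := t * g a (c + 1) + q ^ c * qInt q a * (g (a - 1) c + g (a - 1) (c + 1))
  map_add' f g := by ext a c; simp only [Pi.add_apply]; ring
  map_smul' r f := by
    ext a c; simp only [Pi.smul_apply, smul_eq_mul, RingHom.id_apply]; ring

/-- The part of the Jacobi operator that acts on arcs opened in the current block. -/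
noncomputable def innerStep (q : ℝ) : Module.End ℝ (ℕ → ℕ → ℝ) where
  toFun g a c := qInt q c * (g a (c - 1) + g a c)
  map_add' f g := by ext a c; simp only [Pi.add_apply]; ring
  map_smul' r f := by
    ext a c; simp only [Pi.smul_apply, smul_eq_mul, RingHom.id_apply]; ring

/-- A function of the number of open arcs, as a function of the two kinds of open arcs. -/
def spread : (ℕ → ℝ) →ₗ[ℝ] (ℕ → ℕ → ℝ) where
  toFun f a c := f (a + c)
  map_add' _ _ := rfl
  map_smul' _ _ := rfl

/-- This comes from `[c+1]_q = 1 + q [c]_q` wherever the outer step raises `c`; at `c = 0` the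
truncated `c - 1` is harmless since `[0]_q = 0`. -/
lemma blockStep_mul_innerStep (q t : ℝ) :
    blockStep q t * innerStep q =
      q • (innerStep q * blockStep q t) + (blockStep q t + t • 1) := by
  ext g a c
  simp only [blockStep, innerStep, Module.End.mul_apply, LinearMap.coe_mk, AddHom.coe_mk,
    LinearMap.add_apply, LinearMap.smul_apply, Module.End.one_apply, Pi.add_apply, Pi.smul_apply,
    smul_eq_mul, Nat.add_sub_cancel, qInt_succ]
  cases c with
  | zero => simp; ring
  | succ c => simp only [Nat.add_sub_cancel, qInt_succ]; ring

lemma blockStep_pow_mul_innerStep (q t : ℝ) (m : ℕ) :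
    blockStep q t ^ m * innerStep q = q ^ m • (innerStep q * blockStep q t ^ m) +
      qInt q m • (blockStep q t ^ m + t • blockStep q t ^ (m - 1)) := by
  induction m with
  | zero => simp
  | succ m ih =>
    have key : qInt q m • (blockStep q t * blockStep q t ^ (m - 1)) =
        qInt q m • blockStep q t ^ m := by
      cases m with
      | zero => simp
      | succ m => rw [Nat.add_sub_cancel, ← pow_succ']
    rw [pow_succ', mul_assoc, ih, mul_add, mul_smul_comm, ← mul_assoc, blockStep_mul_innerStep,
      mul_smul_comm, mul_add, mul_smul_comm, smul_add, smul_comm _ t, key, qInt_succ',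
      Nat.add_sub_cancel]
    simp only [add_mul, smul_mul_assoc, mul_assoc, one_mul, ← pow_succ', smul_add, add_smul,
      smul_smul, pow_succ q]
    simp only [mul_comm t]
    abel

/-- The splitting `[a+c]_q = q^c [a]_q + [c]_q` separates the closing of an older arc from that of
an arc of the current block. -/
lemma spread_jacobi (q t : ℝ) (f : ℕ → ℝ) :
    spread (jacobi q t f) = blockStep q t (spread f) + innerStep q (spread f) := by
  ext a c
  simp only [spread, jacobi, blockStep, innerStep, LinearMap.coe_mk, AddHom.coe_mk, Pi.add_apply,
    qInt_add]
  rcases a with _ | a <;> rcases c with _ | c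
  · simp
  · simp [add_assoc]
  · simp
  · simp only [Nat.add_sub_cancel, show a + (c + 1) = a + 1 + c by ring, ← add_assoc]
    ring

/-- The transfer operator of a block of `m` elements. -/
noncomputable def blockOp (q t : ℝ) (m : ℕ) (f : ℕ → ℝ) : ℕ → ℝ :=
  fun h => ((blockStep q t ^ m) (spread f)) h 0

/-- Moving `innerStep` to the left of the power leaves a term that vanishes at `c = 0`, where a
block starts. -/
lemma blockOp_jacobi (q t : ℝ) (m : ℕ) (f : ℕ → ℝ) :
    blockOp q t m (jacobi q t f) = blockOp q t (m + 1) f +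
      qInt q m • (blockOp q t m f + t • blockOp q t (m - 1) f) := by
  ext h
  have := congrArg (fun T : Module.End ℝ (ℕ → ℕ → ℝ) => T (spread f) h 0)
    (blockStep_pow_mul_innerStep q t m)
  simp only [Module.End.mul_apply, LinearMap.add_apply, LinearMap.smul_apply, Pi.add_apply,
    Pi.smul_apply, smul_eq_mul] at this
  simp only [blockOp, spread_jacobi, map_add, Pi.add_apply, Pi.smul_apply, smul_eq_mul, this,
    pow_succ, Module.End.mul_apply]
  simp [innerStep]

lemma blockOp_eq_aeval (q t : ℝ) (m : ℕ) (f : ℕ → ℝ) :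
    blockOp q t m f = aeval (jacobi q t) (bigQHermite q t m) f := by
  induction m using Nat.strong_induction_on generalizing f with
  | _ m ih =>
  cases m with
  | zero => ext h; simp [blockOp, spread, bigQHermite]
  | succ m =>
    have h1 := (blockOp_jacobi q t m f).symm
    rw [ih m (by omega), ih m (by omega), ih (m - 1) (by omega)] at h1
    rw [← eq_sub_iff_add_eq] at h1
    rw [h1, bigQHermite_succ, mul_comm (X - _) _, mul_sub]
    simp only [map_sub, map_mul, aeval_X, aeval_C, Module.End.mul_apply, LinearMap.sub_apply,
      Module.algebraMap_end_apply, map_smul, smul_add, smul_smul]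
    abel

/-- The value at `h` of the transfer operators of the blocks `ns`: the weighted number of ways to
complete `h` open arcs. -/
noncomputable def transfer (q t : ℝ) : List ℕ → ℕ → ℝ
  | [] => Pi.single 0 1
  | n :: ns => blockOp q t n (transfer q t ns)

lemma transfer_eq_aeval (q t : ℝ) (ns : List ℕ) :
    transfer q t ns = aeval (jacobi q t) (ns.map (bigQHermite q t)).prod (Pi.single 0 1) := by
  induction ns with
  | nil => simp [transfer]
  | cons n ns ih => simp [transfer, blockOp_eq_aeval, ih]

/-! ### Action on the vacuum, expansion coefficients and integrals -/

lemma jacobi_single (q t : ℝ) (n : ℕ) :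
    jacobi q t (Pi.single n 1) = qInt q (n + 1) • Pi.single (n + 1) 1 +
      qInt q n • Pi.single n 1 + (if n = 0 then 0 else t • Pi.single (n - 1) 1) := by
  ext h
  simp only [jacobi, LinearMap.coe_mk, AddHom.coe_mk, Pi.add_apply, Pi.smul_apply, smul_eq_mul,
    Pi.single_apply]
  rcases n with _ | n <;> rcases h with _ | h <;> simp [Pi.single_apply]
  · split_ifs with h1
    · simp [h1]
    · simp
  · simp only [eq_comm]
  · rcases lt_trichotomy h n with h1 | rfl | h1
    · simp [h1.ne, show h ≠ n + 1 by omega]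
    · simp
    · rcases eq_or_ne h (n + 1) with rfl | h2
      · simp [show n + 1 + 1 ≠ n by omega]
      · simp [h1.ne', h2, show h + 1 ≠ n by omega]

lemma aeval_bigQHermite_single (q t : ℝ) (m : ℕ) :
    aeval (jacobi q t) (bigQHermite q t m) (Pi.single 0 1) = qFact q m • Pi.single m 1 := by
  induction m using Nat.strong_induction_on with
  | _ m ih =>
  cases m with
  | zero => simp [bigQHermite, qFact]
  | succ m =>
    rw [bigQHermite_succ]
    simp only [map_sub, map_mul, aeval_X, aeval_C, Module.End.mul_apply, LinearMap.sub_apply,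
      Module.algebraMap_end_apply, sub_mul]
    rw [ih m (by omega), ih (m - 1) (by omega), map_smul, jacobi_single, qFact_succ]
    cases m with
    | zero => simp
    | succ m =>
      simp only [Nat.add_sub_cancel, qFact_succ, if_neg (Nat.succ_ne_zero m)]
      module

/-- With no older arc to close, every point of the block must open one. -/
lemma blockOp_apply_zero (q t : ℝ) (m : ℕ) (f : ℕ → ℝ) : blockOp q t m f 0 = t ^ m * f m := by
  have : ∀ c, ((blockStep q t ^ m) (spread f)) 0 c = t ^ m * f (m + c) := by
    induction m with
    | zero => simp [spread]
    | succ m ih =>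
      intro c
      rw [pow_succ', Module.End.mul_apply]
      simp only [blockStep, LinearMap.coe_mk, AddHom.coe_mk] at ih ⊢
      rw [ih]
      simp only [qInt_zero, mul_zero, zero_mul, add_zero]
      rw [show m + (c + 1) = m + 1 + c by ring]
      ring
  simpa [blockOp] using this 0

lemma transfer_append_singleton (q t : ℝ) (ns : List ℕ) (m : ℕ) :
    transfer q t (ns ++ [m]) 0 = t ^ m * transfer q t ns m := by
  have : transfer q t (ns ++ [m]) = transfer q t (m :: ns) := by
    rw [transfer_eq_aeval, transfer_eq_aeval]
    simp [mul_comm]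
  rw [this, transfer, blockOp_apply_zero]

lemma span_bigQHermite (q t : ℝ) : Submodule.span ℝ (Set.range (bigQHermite q t)) = ⊤ := by
  rw [eq_top_iff]
  have hX : ∀ p ∈ Submodule.span ℝ (Set.range (bigQHermite q t)),
      X * p ∈ Submodule.span ℝ (Set.range (bigQHermite q t)) := by
    intro p hp
    induction hp using Submodule.span_induction with
    | mem p hp =>
      obtain ⟨m, rfl⟩ := hp
      have : X * bigQHermite q t m = bigQHermite q t (m + 1) + qInt q m • bigQHermite q t m +
          (t * qInt q m) • bigQHermite q t (m - 1) := by
        rw [bigQHermite_succ, smul_eq_C_mul, smul_eq_C_mul]; ring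
      rw [this]
      have hm (k : ℕ) := Submodule.subset_span (R := ℝ) (Set.mem_range_self (f := bigQHermite q t) k)
      exact add_mem (add_mem (hm _) (Submodule.smul_mem _ _ (hm _))) (Submodule.smul_mem _ _ (hm _))
    | zero => simp
    | add p r _ _ hp hr => rw [mul_add]; exact add_mem hp hr
    | smul c p _ hp => rw [mul_smul_comm]; exact Submodule.smul_mem _ _ hp
  have hpow : ∀ n : ℕ, (X : ℝ[X]) ^ n ∈ Submodule.span ℝ (Set.range (bigQHermite q t)) := by
    intro n
    induction n with
    | zero => exact Submodule.subset_span ⟨0, by simp [bigQHermite]⟩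
    | succ n ih => rw [pow_succ']; exact hX _ ih
  intro p _
  rw [p.as_sum_range_C_mul_X_pow]
  exact sum_mem fun i _ => by rw [← smul_eq_C_mul]; exact Submodule.smul_mem _ _ (hpow i)

lemma natDegree_bigQHermite_le (q t : ℝ) (m : ℕ) : (bigQHermite q t m).natDegree ≤ m := by
  induction m using Nat.strong_induction_on with
  | _ m ih =>
  cases m with
  | zero => simp [bigQHermite]
  | succ m =>
    rw [bigQHermite_succ]
    refine (natDegree_sub_le _ _).trans (max_le ?_ ?_)
    · refine natDegree_mul_le.trans ?_
      rw [natDegree_X_sub_C]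
      have := ih m (by omega)
      omega
    · refine (natDegree_C_mul_le _ _).trans ((ih (m - 1) (by omega)).trans (by omega))

lemma jacobi_apply_eq_zero (q t : ℝ) {f : ℕ → ℝ} {n : ℕ} (hf : ∀ m, n < m → f m = 0) {m : ℕ}
    (hm : n + 1 < m) : jacobi q t f m = 0 := by
  simp [jacobi, hf (m + 1) (by omega), hf (m - 1) (by omega), hf m (by omega)]

lemma aeval_jacobi_single_eq_zero (q t : ℝ) (p : ℝ[X]) {m : ℕ} (hm : p.natDegree < m) :
    aeval (jacobi q t) p (Pi.single 0 1) m = 0 := by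
  have hpow : ∀ n m : ℕ, n < m → (jacobi q t ^ n) (Pi.single 0 1) m = 0 := by
    intro n
    induction n with
    | zero => intro m hm; simp [hm.ne']
    | succ n ih =>
      intro m hm
      rw [pow_succ', Module.End.mul_apply]
      exact jacobi_apply_eq_zero q t ih hm
  rw [aeval_eq_sum_range, LinearMap.sum_apply, Finset.sum_apply]
  refine Finset.sum_eq_zero fun i hi => ?_
  rw [Finset.mem_range] at hi
  simp [hpow i m (by omega)]

/-- Every polynomial is the combination of the `bigQHermite q t m` whose coefficients are read off
from its action on the vacuum. -/
lemma eq_sum_bigQHermite {q : ℝ} (hq : -1 < q) (hq1 : q < 1) (t : ℝ) (p : ℝ[X]) {n : ℕ}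
    (hp : p.natDegree ≤ n) :
    p = ∑ m ∈ Finset.range (n + 1),
      C (aeval (jacobi q t) p (Pi.single 0 1) m / qFact q m) * bigQHermite q t m := by
  -- The degree enters only through the vanishing of the entries from `N` on, so `p` can be replaced
  -- by an arbitrary finite combination.
  have main : ∀ N, (∀ m, N ≤ m → aeval (jacobi q t) p (Pi.single 0 1) m = 0) →
      p = ∑ m ∈ Finset.range N,
        C (aeval (jacobi q t) p (Pi.single 0 1) m / qFact q m) * bigQHermite q t m := by
    have hmem : p ∈ Submodule.span ℝ (Set.range (bigQHermite q t)) := by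
      rw [span_bigQHermite]; trivial
    rw [Finsupp.mem_span_range_iff_exists_finsupp] at hmem
    obtain ⟨c, rfl⟩ := hmem
    intro N hN
    have hc : ∀ m, aeval (jacobi q t) (c.sum fun i a => a • bigQHermite q t i)
        (Pi.single 0 1) m = c m * qFact q m := by
      intro m
      simp only [Finsupp.sum, map_sum, map_smul, LinearMap.sum_apply, LinearMap.smul_apply,
        aeval_bigQHermite_single, Finset.sum_apply, Pi.smul_apply, smul_eq_mul, Pi.single_apply]
      rw [Finset.sum_eq_single m]
      · simp
      · intro b _ hb; simp [hb.symm]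
      · intro h; simp [Finsupp.notMem_support_iff.1 h]
    simp only [hc] at hN ⊢
    have hz : ∀ m, N ≤ m → c m = 0 := fun m hm =>
      (mul_eq_zero.1 (hN m hm)).resolve_right (qFact_pos hq hq1 m).ne'
    rw [Finsupp.sum_of_support_subset (s := Finset.range N)]
    · refine Finset.sum_congr rfl fun m _ => ?_
      rw [mul_div_cancel_right₀ _ (qFact_pos hq hq1 m).ne', smul_eq_C_mul]
    · intro m hm
      by_contra h
      exact Finsupp.mem_support_iff.1 hm (hz m (by simpa using h))
    · simp
  exact main (n + 1) fun m hm => aeval_jacobi_single_eq_zero q t p (by omega)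

lemma natDegree_prod_bigQHermite_le (q t : ℝ) (ns : List ℕ) :
    (ns.map (bigQHermite q t)).prod.natDegree ≤ ns.sum := by
  induction ns with
  | nil => simp
  | cons n ns ih =>
    simp only [List.map_cons, List.prod_cons, List.sum_cons]
    exact natDegree_mul_le.trans (add_le_add (natDegree_bigQHermite_le q t n) ih)

/-- Both sides are linear in `p`, and on the spanning family both vanish except at `C_{q,0} = 1`; on
the left this is orthogonality to `1`. -/
lemma integral_eval_eq {q t : ℝ} {μ : Measure ℝ} (hμ : IsOrthogonalityMeasure q t μ) (p : ℝ[X]) :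
    ∫ x, p.eval x ∂μ = aeval (jacobi q t) p (Pi.single 0 1) 0 := by
  have hmem : p ∈ Submodule.span ℝ (Set.range (bigQHermite q t)) := by
    rw [span_bigQHermite]; trivial
  have := hμ.isProbabilityMeasure
  induction hmem using Submodule.span_induction with
  | mem p hp =>
    obtain ⟨m, rfl⟩ := hp
    rw [aeval_bigQHermite_single]
    rcases m with _ | m
    · simp [bigQHermite, qFact]
    · have := hμ.orthogonal (m + 1) 0 (by simp)
      simpa [bigQHermite, Pi.single_apply] using this
  | zero => simp
  | add p r _ _ hp hr =>
    simp [integral_add (hμ.integrable_eval p) (hμ.integrable_eval r), hp, hr]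
  | smul c p _ hp => simp [integral_const_mul, hp]

/-! ### Counting arc diagrams point by point -/

section

/-- `A` is the set of arcs `(i, k)` with `n ≤ k < N` of an arc diagram on `{0, …, N-1}` without
isolated points and without arcs inside the classes of `b`, in which the points `u < n` that are
the source of such an arc are those of `U`. -/
structure IsCompletion (b : ℕ → ℕ) (N n : ℕ) (U : Finset ℕ) (A : Finset (ℕ × ℕ)) : Prop where
  bounds : ∀ {i k}, (i, k) ∈ A → n ≤ k ∧ k < N ∧ i < k ∧ b i ≠ b k ∧ (i ∈ U ∨ n ≤ i)
  right_unique : ∀ {i k l}, (i, k) ∈ A → (i, l) ∈ A → k = l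
  left_unique : ∀ {i j k}, (i, k) ∈ A → (j, k) ∈ A → i = j
  covers : ∀ {u}, u ∈ U → ∃ k, (u, k) ∈ A
  not_isolated : ∀ {k}, n ≤ k → k < N → (∃ i, (i, k) ∈ A) ∨ ∃ l, (k, l) ∈ A

/-- The number of crossing pairs of arcs of `A`. -/
def arcCrossings (A : Finset (ℕ × ℕ)) : ℕ :=
  ((A ×ˢ A).filter fun x => x.1.1 < x.2.1 ∧ x.2.1 < x.1.2 ∧ x.1.2 < x.2.2).card

/-- The points of `{n, …, N-1}` at which no arc of `A` ends. -/
def openers (N n : ℕ) (A : Finset (ℕ × ℕ)) : Finset ℕ :=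
  (Finset.Ico n N).filter fun k => ∀ x ∈ A, x.2 ≠ k

/-- The weight of the arc diagram `A` on `{n, …, N-1}`. -/
def arcWeight (q t : ℝ) (N n : ℕ) (A : Finset (ℕ × ℕ)) : ℝ :=
  q ^ arcCrossings A * t ^ (openers N n A).card

open Classical in
/-- The finite set of completions. -/
noncomputable def completions (b : ℕ → ℕ) (N n : ℕ) (U : Finset ℕ) : Finset (Finset (ℕ × ℕ)) :=
  (Finset.range N ×ˢ Finset.range N).powerset.filter (IsCompletion b N n U)

lemma mem_completions {b : ℕ → ℕ} {N n : ℕ} {U : Finset ℕ} {A : Finset (ℕ × ℕ)} :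
    A ∈ completions b N n U ↔ IsCompletion b N n U A := by
  simp only [completions, Finset.mem_filter, Finset.mem_powerset, and_iff_right_iff_imp]
  rintro h ⟨i, k⟩ hik
  have := h.bounds hik
  simp only [Finset.mem_product, Finset.mem_range]
  omega

/-- The weighted number of completions. -/
noncomputable def completionSum (b : ℕ → ℕ) (q t : ℝ) (N n : ℕ) (U : Finset ℕ) : ℝ :=
  ∑ A ∈ completions b N n U, arcWeight q t N n A

variable {b : ℕ → ℕ} {N n u : ℕ} {U : Finset ℕ} {A : Finset (ℕ × ℕ)}

lemma isCompletion_and_forall_ne_iff (hn : n < N) (hU : U ⊆ Finset.range n) :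
    IsCompletion b N n U A ∧ (∀ i, (i, n) ∉ A) ↔ IsCompletion b N (n + 1) (insert n U) A := by
  have hU' : ∀ u ∈ U, u < n := fun u hu => by simpa using hU hu
  constructor
  · rintro ⟨h, hne⟩
    refine ⟨fun {i k} hik => ?_, h.right_unique, h.left_unique, fun {u} hu => ?_,
      fun hk => h.not_isolated (by omega)⟩
    · obtain ⟨h1, h2, h3, h4, h5⟩ := h.bounds hik
      have : k ≠ n := by rintro rfl; exact hne _ hik
      simp only [Finset.mem_insert]
      refine ⟨by omega, h2, h3, h4, ?_⟩
      rcases h5 with h5 | h5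
      · exact Or.inl (Or.inr h5)
      · omega
    · rcases Finset.mem_insert.1 hu with rfl | hu
      · exact (h.not_isolated le_rfl hn).resolve_left fun ⟨i, hi⟩ => hne i hi
      · exact h.covers hu
  · intro h
    have hne : ∀ i, (i, n) ∉ A := fun i hi => by have := (h.bounds hi).1; omega
    refine ⟨⟨fun {i k} hik => ?_, h.right_unique, h.left_unique,
      fun hu => h.covers (Finset.mem_insert_of_mem hu), fun {k} hk hkN => ?_⟩, hne⟩
    · obtain ⟨h1, h2, h3, h4, h5⟩ := h.bounds hik
      rw [Finset.mem_insert] at h5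
      refine ⟨by omega, h2, h3, h4, ?_⟩
      rcases h5 with (h5 | h5) | h5
      · right; omega
      · exact Or.inl h5
      · right; omega
    · rcases hk.eq_or_lt with rfl | hk
      · exact Or.inr (h.covers (Finset.mem_insert_self _ _))
      · exact h.not_isolated hk hkN

lemma IsCompletion.insert_arc {W : Finset ℕ} (hn : n < N) (hU : U ⊆ Finset.range n) (hu : u ∈ U)
    (hb : b u ≠ b n) (hW : W = U.erase u ∨ W = insert n (U.erase u))
    (h : IsCompletion b N (n + 1) W A) : IsCompletion b N n U (insert (u, n) A) := by
  have hU' : ∀ u ∈ U, u < n := fun u hu => by simpa using hU hu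
  have hun := hU' u hu
  have hnu : ∀ k, (u, k) ∉ A := fun k hk => by
    obtain ⟨-, -, -, -, h5⟩ := h.bounds hk
    rcases hW with rfl | rfl <;> grind
  have hnn : ∀ i, (i, n) ∉ A := fun i hi => by have := (h.bounds hi).1; omega
  have hWU : ∀ i ∈ W, i ∈ U ∨ i = n := by rcases hW with rfl | rfl <;> grind
  have hUW : ∀ i ∈ U, i ≠ u → i ∈ W := by rcases hW with rfl | rfl <;> grind
  refine ⟨fun {i k} hik => ?_, fun {i k l} hk hl => ?_, fun {i j k} hi hj => ?_, fun {v} hv => ?_,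
    fun {k} hk hkN => ?_⟩
  · rw [Finset.mem_insert, Prod.mk.injEq] at hik
    rcases hik with ⟨rfl, rfl⟩ | hik
    · exact ⟨le_rfl, hn, hun, hb, Or.inl hu⟩
    · obtain ⟨h1, h2, h3, h4, h5⟩ := h.bounds hik
      grind
  · have := h.right_unique (i := i) (k := k) (l := l)
    grind
  · have := h.left_unique (i := i) (j := j) (k := k)
    grind
  · by_cases hvu : v = u
    · exact ⟨n, by simp [hvu]⟩
    · obtain ⟨k, hk⟩ := h.covers (hUW v hv hvu)
      exact ⟨k, Finset.mem_insert_of_mem hk⟩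
  · rcases hk.eq_or_lt with rfl | hk
    · exact Or.inl ⟨u, Finset.mem_insert_self _ _⟩
    · rcases h.not_isolated hk hkN with ⟨i, hi⟩ | ⟨l, hl⟩
      · exact Or.inl ⟨i, Finset.mem_insert_of_mem hi⟩
      · exact Or.inr ⟨l, Finset.mem_insert_of_mem hl⟩

lemma IsCompletion.erase_arc (hU : U ⊆ Finset.range n) (h : IsCompletion b N n U A)
    (hA : (u, n) ∈ A) : u ∈ U ∧ b u ≠ b n ∧
      (IsCompletion b N (n + 1) (U.erase u) (A.erase (u, n)) ∨
        IsCompletion b N (n + 1) (insert n (U.erase u)) (A.erase (u, n))) := by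
  have hU' : ∀ u ∈ U, u < n := fun u hu => by simpa using hU hu
  obtain ⟨-, hn, hun, hb, h5⟩ := h.bounds hA
  have hu : u ∈ U := by rcases h5 with h5 | h5; exacts [h5, by omega]
  refine ⟨hu, hb, ?_⟩
  have hbd : ∀ {i k}, (i, k) ∈ A.erase (u, n) →
      n + 1 ≤ k ∧ k < N ∧ i < k ∧ b i ≠ b k ∧ (i ∈ U.erase u ∨ n ≤ i) := by
    intro i k hik
    rw [Finset.mem_erase] at hik
    obtain ⟨h1, h2, h3, h4, h5⟩ := h.bounds hik.2
    have hk : k ≠ n := by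
      rintro rfl
      exact hik.1 (by rw [h.left_unique hik.2 hA])
    have hi : i ≠ u := by
      rintro rfl
      exact hik.1 (by rw [h.right_unique hik.2 hA])
    exact ⟨by omega, h2, h3, h4, by simpa [hi] using h5⟩
  have hr : ∀ {i k l}, (i, k) ∈ A.erase (u, n) → (i, l) ∈ A.erase (u, n) → k = l :=
    fun hk hl => h.right_unique (Finset.mem_of_mem_erase hk) (Finset.mem_of_mem_erase hl)
  have hl : ∀ {i j k}, (i, k) ∈ A.erase (u, n) → (j, k) ∈ A.erase (u, n) → i = j :=
    fun hk hl => h.left_unique (Finset.mem_of_mem_erase hk) (Finset.mem_of_mem_erase hl)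
  have hc : ∀ {v}, v ∈ U.erase u → ∃ k, (v, k) ∈ A.erase (u, n) := by
    intro v hv
    rw [Finset.mem_erase] at hv
    obtain ⟨k, hk⟩ := h.covers hv.2
    exact ⟨k, by simp [hv.1, hk]⟩
  have hs : ∀ {k}, n + 1 ≤ k → k < N →
      (∃ i, (i, k) ∈ A.erase (u, n)) ∨ ∃ l, (k, l) ∈ A.erase (u, n) := by
    intro k hk hkN
    rcases h.not_isolated (by omega) hkN with ⟨i, hi⟩ | ⟨l, hl⟩
    · exact Or.inl ⟨i, by simp [hi]; omega⟩
    · exact Or.inr ⟨l, by simp [hl]; omega⟩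
  by_cases hnA : ∃ l, (n, l) ∈ A
  · right
    refine ⟨fun {i k} hik => ?_, hr, hl, fun {v} hv => ?_, hs⟩
    · have := hbd hik
      grind
    · rcases Finset.mem_insert.1 hv with rfl | hv
      · obtain ⟨l, hl⟩ := hnA
        exact ⟨l, by simp [hl]; omega⟩
      · exact hc hv
  · left
    refine ⟨fun {i k} hik => ?_, hr, hl, hc, hs⟩
    have := hbd hik
    have : i ≠ n := by rintro rfl; exact hnA ⟨k, Finset.mem_of_mem_erase hik⟩
    grind

/-- All arcs of `A` end after `n`, so `(u, n)` can only be the left arc of a crossing. It crosses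
precisely the arcs that start strictly between `u` and `n`, one for each `j ∈ U` with `u < j`. -/
lemma arcCrossings_insert {W : Finset ℕ} (hU : U ⊆ Finset.range n) (hu : u ∈ U)
    (hW : W = U.erase u ∨ W = insert n (U.erase u)) (h : IsCompletion b N (n + 1) W A) :
    arcCrossings (insert (u, n) A) = (U.filter fun j => u < j).card + arcCrossings A := by
  have hU' : ∀ u ∈ U, u < n := fun u hu => by simpa using hU hu
  have hb : ∀ x ∈ A, n + 1 ≤ x.2 := fun x hx => (h.bounds (i := x.1) (k := x.2) hx).1
  have hWU : ∀ i ∈ W, i ∈ U ∨ i = n := by rcases hW with rfl | rfl <;> grind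
  have hUW : ∀ i ∈ U, i ≠ u → i ∈ W := by rcases hW with rfl | rfl <;> grind
  have hsplit : ((insert (u, n) A ×ˢ insert (u, n) A).filter
      fun x => x.1.1 < x.2.1 ∧ x.2.1 < x.1.2 ∧ x.1.2 < x.2.2) =
      ((A.filter fun y => u < y.1 ∧ y.1 < n).image fun y => ((u, n), y)) ∪
      ((A ×ˢ A).filter fun x => x.1.1 < x.2.1 ∧ x.2.1 < x.1.2 ∧ x.1.2 < x.2.2) := by
    ext ⟨⟨i, k⟩, ⟨j, l⟩⟩
    have h1 := hb (i, k)
    have h2 := hb (j, l)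
    simp only [Finset.mem_filter, Finset.mem_product, Finset.mem_insert, Prod.mk.injEq,
      Finset.mem_union, Finset.mem_image, Prod.exists] at h1 h2 ⊢
    constructor
    · rintro ⟨⟨⟨rfl, rfl⟩ | hik, ⟨rfl, rfl⟩ | hjl⟩, h3, h4, h5⟩
      · omega
      · exact Or.inl ⟨j, l, ⟨hjl, h3, h4⟩, by simp⟩
      · have := h1 hik; omega
      · exact Or.inr ⟨⟨hik, hjl⟩, h3, h4, h5⟩
    · rintro (⟨j, l, ⟨hjl, h3, h4⟩, ⟨rfl, rfl⟩, rfl, rfl⟩ | ⟨⟨hik, hjl⟩, h3, h4, h5⟩)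
      · exact ⟨⟨Or.inl ⟨rfl, rfl⟩, Or.inr hjl⟩, h3, h4, h2 hjl⟩
      · exact ⟨⟨Or.inr hik, Or.inr hjl⟩, h3, h4, h5⟩
  rw [arcCrossings, hsplit, Finset.card_union_of_disjoint, arcCrossings,
    Finset.card_image_of_injective _ (fun x y hxy => by simpa using hxy)]
  · congr 1
    refine Finset.card_bij (fun y _ => y.1) ?_ ?_ ?_
    · rintro ⟨j, l⟩ hj
      simp only [Finset.mem_filter] at hj ⊢
      have := (h.bounds hj.1).2.2.2.2
      grind
    · rintro ⟨j, l⟩ hj ⟨j', l'⟩ hj' (rfl : j = j')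
      simp only [Finset.mem_filter] at hj hj'
      rw [h.right_unique hj.1 hj'.1]
    · intro j hj
      rw [Finset.mem_filter] at hj
      obtain ⟨l, hl⟩ := h.covers (hUW j hj.1 hj.2.ne')
      exact ⟨(j, l), by simp [hl, hj.2, hU' j hj.1], rfl⟩
  · rw [Finset.disjoint_left]
    rintro ⟨x, y⟩ hx hy
    simp only [Finset.mem_image, Finset.mem_filter, Finset.mem_product, Prod.mk.injEq] at hx hy
    obtain ⟨_, _, rfl, _⟩ := hx
    have := hb _ hy.1.1
    simp at this

lemma openers_insert :
    openers N n (insert (u, n) A) = openers N (n + 1) A := by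
  ext k
  simp only [openers, Finset.mem_filter, Finset.mem_Ico, Finset.mem_insert, forall_eq_or_imp]
  constructor
  · rintro ⟨h1, h2, h3⟩
    exact ⟨⟨by omega, h1.2⟩, h3⟩
  · rintro ⟨h1, h2⟩
    exact ⟨⟨by omega, h1.2⟩, by omega, h2⟩

lemma card_openers_of_lt (hn : n < N) (hA : ∀ x ∈ A, n + 1 ≤ x.2) :
    (openers N n A).card = (openers N (n + 1) A).card + 1 := by
  have : openers N n A = insert n (openers N (n + 1) A) := by
    ext k
    simp only [openers, Finset.mem_filter, Finset.mem_Ico, Finset.mem_insert]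
    constructor
    · rintro ⟨h1, h2⟩
      by_cases h : k = n
      · exact Or.inl h
      · exact Or.inr ⟨⟨by omega, h1.2⟩, h2⟩
    · rintro (rfl | ⟨h1, h2⟩)
      · exact ⟨⟨le_rfl, hn⟩, fun x hx => by have := hA x hx; omega⟩
      · exact ⟨⟨by omega, h1.2⟩, h2⟩
  rw [this, Finset.card_insert_of_notMem (by simp [openers])]

/-- Either no arc ends at `n`, which must then open one, or the arc from some `u ∈ U` ends there,
after which `n` may or may not open another. -/
lemma completionSum_step (q t : ℝ) (hn : n < N) (hU : U ⊆ Finset.range n) :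
    completionSum b q t N n U = t * completionSum b q t N (n + 1) (insert n U) +
      ∑ u ∈ U.filter (fun u => b u ≠ b n), q ^ (U.filter fun j => u < j).card *
        (completionSum b q t N (n + 1) (U.erase u) +
          completionSum b q t N (n + 1) (insert n (U.erase u))) := by
  classical
  have hU' : ∀ u ∈ U, u < n := fun u hu => by simpa using hU hu
  rw [completionSum, ← Finset.sum_filter_add_sum_filter_not _ fun A => ∀ i, (i, n) ∉ A]
  congr 1
  · have : (completions b N n U).filter (fun A => ∀ i, (i, n) ∉ A) =
        completions b N (n + 1) (insert n U) := by
      ext A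
      rw [Finset.mem_filter, mem_completions, mem_completions,
        isCompletion_and_forall_ne_iff hn hU]
    rw [this, completionSum, Finset.mul_sum]
    refine Finset.sum_congr rfl fun A hA => ?_
    rw [mem_completions] at hA
    rw [arcWeight, arcWeight, card_openers_of_lt hn fun x hx => (hA.bounds (i := x.1) hx).1]
    ring
  -- The two families differ in whether an arc starts at `n`.
  · have hdisj : ∀ u, Disjoint (completions b N (n + 1) (U.erase u))
        (completions b N (n + 1) (insert n (U.erase u))) := by
      intro u
      rw [Finset.disjoint_left]
      intro A h1 h2
      rw [mem_completions] at h1 h2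
      obtain ⟨k, hk⟩ := h2.covers (Finset.mem_insert_self _ _)
      have := (h1.bounds hk).2.2.2.2
      grind
    simp_rw [completionSum, ← Finset.sum_union (hdisj _), Finset.mul_sum]
    rw [Finset.sum_sigma']
    have hmem : ∀ x : (_ : ℕ) × Finset (ℕ × ℕ), x ∈ ((U.filter fun u => b u ≠ b n).sigma fun u =>
        completions b N (n + 1) (U.erase u) ∪ completions b N (n + 1) (insert n (U.erase u))) →
        x.1 ∈ U ∧ b x.1 ≠ b n ∧ ∃ W, (W = U.erase x.1 ∨ W = insert n (U.erase x.1)) ∧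
          IsCompletion b N (n + 1) W x.2 := by
      intro x hx
      simp only [Finset.mem_sigma, Finset.mem_filter, Finset.mem_union, mem_completions] at hx
      refine ⟨hx.1.1, hx.1.2, ?_⟩
      rcases hx.2 with h | h
      · exact ⟨_, Or.inl rfl, h⟩
      · exact ⟨_, Or.inr rfl, h⟩
    symm
    refine Finset.sum_bij (fun x _ => insert (x.1, n) x.2) ?_ ?_ ?_ ?_
    · intro x hx
      obtain ⟨hu, hb, W, hW, h⟩ := hmem x hx
      rw [Finset.mem_filter, mem_completions]
      exact ⟨h.insert_arc hn hU hu hb hW, fun h => h x.1 (Finset.mem_insert_self _ _)⟩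
    · rintro ⟨u, A⟩ hx ⟨v, B⟩ hy hxy
      obtain ⟨hu, hb, W, hW, h⟩ := hmem _ hx
      obtain ⟨hu', hb', W', hW', h'⟩ := hmem _ hy
      have hA : ∀ i, (i, n) ∉ A := fun i hi => by have := (h.bounds hi).1; omega
      have hB : ∀ i, (i, n) ∉ B := fun i hi => by have := (h'.bounds hi).1; omega
      simp only at hxy
      have huv : u = v := by
        have : (u, n) ∈ insert (v, n) B := hxy ▸ Finset.mem_insert_self _ _
        simpa [hB] using this
      subst huv
      rw [← Finset.erase_insert (hA u), hxy, Finset.erase_insert (hB u)]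
    · intro A hA
      rw [Finset.mem_filter, mem_completions] at hA
      obtain ⟨hA, hne⟩ := hA
      push Not at hne
      obtain ⟨u, hu⟩ := hne
      obtain ⟨h1, h2, h3⟩ := hA.erase_arc hU hu
      exact ⟨⟨u, A.erase (u, n)⟩, by simp [h1, h2, mem_completions, h3], by simp [hu]⟩
    · intro x hx
      obtain ⟨hu, hb, W, hW, h⟩ := hmem x hx
      rw [arcWeight, arcWeight, arcCrossings_insert hU hu hW h,
        openers_insert]
      ring

/-- The exponents run through `0, …, |W| - 1`, once each. -/
lemma sum_pow_card_filter_lt (q : ℝ) (W : Finset ℕ) :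
    ∑ u ∈ W, q ^ (W.filter fun j => u < j).card = qInt q W.card := by
  induction W using Finset.induction_on_min with
  | empty => simp
  | insert x W hx ih =>
    have hxW : x ∉ W := fun h => (hx x h).false
    rw [Finset.sum_insert hxW, Finset.card_insert_of_notMem hxW, qInt_succ', ← ih, add_comm]
    congr 1
    · refine Finset.sum_congr rfl fun u hu => ?_
      rw [Finset.filter_insert, if_neg (hx u hu).not_gt]
    · rw [Finset.filter_insert, if_neg (lt_irrefl x), Finset.filter_true_of_mem hx]

lemma completionSum_self (q t : ℝ) (hU : U ⊆ Finset.range N) :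
    completionSum b q t N N U = if U.card = 0 then 1 else 0 := by
  have key : ∀ A, IsCompletion b N N U A ↔ A = ∅ ∧ U = ∅ := by
    intro A
    constructor
    · intro h
      have hA : A = ∅ := by
        rw [Finset.eq_empty_iff_forall_notMem]
        rintro ⟨i, k⟩ hik
        have := h.bounds hik
        omega
      refine ⟨hA, Finset.eq_empty_iff_forall_notMem.2 fun u hu => ?_⟩
      obtain ⟨k, hk⟩ := h.covers hu
      simp [hA] at hk
    · rintro ⟨rfl, rfl⟩
      exact ⟨by simp, by simp, by simp, by simp, fun h1 h2 => by omega⟩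
  rw [completionSum]
  split_ifs with h
  · have : completions b N N U = {∅} := by
      ext A
      rw [mem_completions, key, Finset.mem_singleton, and_iff_left (Finset.card_eq_zero.1 h)]
    simp [this, arcWeight, arcCrossings, openers]
  · have : completions b N N U = ∅ := by
      ext A
      simp [mem_completions, key, Finset.card_eq_zero.not.1 h]
    simp [this]

/-- Inside a block `{s, …, e-1}`, the weighted number of completions is given by the transfer
matrix. -/
lemma completionSum_block (q t : ℝ) (f : ℕ → ℝ) {s e : ℕ} (heN : e ≤ N)
    (hbase : ∀ U ⊆ Finset.range e, completionSum b q t N e U = f U.card)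
    (hold : ∀ i k, i < s → s ≤ k → k < e → b i ≠ b k)
    (hblock : ∀ i k, s ≤ i → i < e → s ≤ k → k < e → b i = b k)
    (m : ℕ) (hsn : s ≤ n) (hne : n + m = e) (hU : U ⊆ Finset.range n) :
    completionSum b q t N n U = ((blockStep q t ^ m) (spread f))
      (U.filter fun u => u < s).card (U.filter fun u => s ≤ u).card := by
  induction m generalizing n U with
  | zero =>
    obtain rfl : n = e := by simpa using hne
    have := Finset.card_filter_add_card_filter_not (s := U) fun u => u < s
    simp only [not_lt] at this
    simp [hbase U hU, spread, this]
  | succ m ih =>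
    have hU' : ∀ u ∈ U, u < n := fun u hu => by simpa using hU hu
    have hnU : n ∉ U := fun h => (hU' n h).false
    have hins : ∀ W ⊆ U, insert n W ⊆ Finset.range (n + 1) := fun W hW x hx => by
      rcases Finset.mem_insert.1 hx with rfl | hx
      · simp
      · have := hU' x (hW hx); simp; omega
    have hsub : ∀ W ⊆ U, W ⊆ Finset.range (n + 1) := fun W hW =>
      (Finset.subset_insert n W).trans (hins W hW)
    -- The arcs that may be closed at `n` are those opened before the block.
    have hfilter : (U.filter fun u => b u ≠ b n) = U.filter fun u => u < s := by
      refine Finset.filter_congr fun u hu => ⟨fun h => ?_, fun h => hold u n h hsn (by omega)⟩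
      by_contra! hsu
      exact h (hblock u n hsu ((hU' u hu).trans (by omega)) hsn (by omega))
    have hlow : ∀ W : Finset ℕ, ((insert n W).filter fun u => u < s) = W.filter fun u => u < s :=
      fun W => by rw [Finset.filter_insert, if_neg hsn.not_gt]
    have hhigh : ∀ W ⊆ U, ((insert n W).filter fun u => s ≤ u).card =
        (W.filter fun u => s ≤ u).card + 1 := fun W hW => by
      rw [Finset.filter_insert, if_pos hsn, Finset.card_insert_of_notMem]
      exact fun h => hnU (hW (Finset.mem_of_mem_filter _ h))
    rw [completionSum_step q t (by omega) hU, hfilter, pow_succ', Module.End.mul_apply]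
    rw [ih (by omega) (by omega) (hins U subset_rfl), hlow, hhigh U subset_rfl]
    simp only [blockStep, LinearMap.coe_mk, AddHom.coe_mk] at ih ⊢
    congr 1
    set a := (U.filter fun u => u < s).card with ha
    set c := (U.filter fun u => s ≤ u).card with hc
    rw [ha, ← sum_pow_card_filter_lt, ← ha, Finset.mul_sum, Finset.sum_mul]
    refine Finset.sum_congr rfl fun u hu => ?_
    rw [Finset.mem_filter] at hu
    have hle := hsub _ (Finset.erase_subset u U)
    have h1 : ((U.erase u).filter fun v => v < s).card = a - 1 := by
      rw [Finset.filter_erase, Finset.card_erase_of_mem (Finset.mem_filter.2 hu)]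
    have h2 : ((U.erase u).filter fun v => s ≤ v).card = c := by
      rw [Finset.filter_erase, Finset.erase_eq_of_notMem]
      simp only [Finset.mem_filter]
      omega
    rw [ih (by omega) (by omega) hle, ih (by omega) (by omega) (hins _ (Finset.erase_subset u U)),
      hlow, hhigh _ (Finset.erase_subset u U), h1, h2, ← pow_add]
    congr 2
    -- The open sources beyond `u` are the `c` sources of the current block, all of them beyond `u`,
    -- and the older sources beyond `u`.
    rw [hc, ← Finset.card_union_of_disjoint]
    · congr 1
      ext j
      simp only [Finset.mem_filter, Finset.mem_union]
      have := hu.2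
      grind
    · rw [Finset.disjoint_left]
      intro j h1 h2
      simp only [Finset.mem_filter] at h1 h2
      omega

/-- At the beginning of the blocks of lengths `ns`, the weighted number of completions is given by
the product of the transfer operators. -/
lemma completionSum_eq_transfer (q t : ℝ) (ns : List ℕ) {e γ : ℕ} (heN : e + ns.sum = N)
    (hlt : ∀ i < e, b i < γ) (hns : ∀ j, b (e + j) = γ + blockIndex ns j)
    (hU : U ⊆ Finset.range e) :
    completionSum b q t N e U = transfer q t ns U.card := by
  induction ns generalizing e γ U with
  | nil =>
    obtain rfl : e = N := by simpa using heN
    simp [completionSum_self q t hU, transfer, Pi.single_apply]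
  | cons m ns ih =>
    rw [List.sum_cons] at heN
    have hb : ∀ k, e ≤ k → k < e + m → b k = γ := fun k h1 h2 => by
      obtain ⟨j, rfl⟩ := Nat.exists_eq_add_of_le h1
      rw [hns, blockIndex, if_pos (by omega), add_zero]
    have hlt' : ∀ i < e + m, b i < γ + 1 := fun i hi => by
      rcases lt_or_ge i e with h | h
      · exact (hlt i h).trans (Nat.lt_succ_self γ)
      · rw [hb i h hi]; exact Nat.lt_succ_self γ
    have hbase : ∀ U ⊆ Finset.range (e + m),
        completionSum b q t N (e + m) U = transfer q t ns U.card := fun U hU =>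
      ih (γ := γ + 1) (by omega) hlt' (fun j => by
        rw [add_assoc, hns, blockIndex, if_neg (by omega), Nat.add_sub_cancel_left]; ring) hU
    have hU' : ∀ u ∈ U, u < e := fun u hu => by simpa using hU hu
    rw [completionSum_block q t (transfer q t ns) (by omega) hbase
      (fun i k h1 h2 h3 => by rw [hb k h2 h3]; exact (hlt i h1).ne)
      (fun i k h1 h2 h3 h4 => by rw [hb i h1 h2, hb k h3 h4]) m le_rfl rfl hU,
      Finset.filter_true_of_mem hU', Finset.filter_false_of_mem fun u hu => (hU' u hu).not_ge]
    rfl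

lemma completionSum_blockIndex (q t : ℝ) (ns : List ℕ) :
    completionSum (blockIndex ns) q t ns.sum 0 ∅ = transfer q t ns 0 := by
  have := completionSum_eq_transfer (b := blockIndex ns) (U := ∅) q t ns (e := 0) (γ := 0)
    (zero_add _) (by simp) (by simp) (by simp)
  simpa using this

end

/-! ### Set partitions as arc diagrams -/

section

lemma blockIndex_mono (ns : List ℕ) : Monotone (blockIndex ns) := by
  induction ns with
  | nil => intro i j _; rfl
  | cons n ns ih =>
    intro i j hij
    have := ih (show i - n ≤ j - n by omega)
    simp only [blockIndex]
    split_ifs <;> omega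

lemma blockIndex_append_singleton (ns : List ℕ) (m : ℕ) {j : ℕ} (hj : j < m) :
    blockIndex (ns ++ [m]) (ns.sum + j) = ns.length := by
  induction ns with
  | nil => simp [blockIndex, hj]
  | cons n ns ih =>
    rw [List.cons_append, List.sum_cons, blockIndex, if_neg (by omega),
      show n + ns.sum + j - n = ns.sum + j by omega, ih, List.length_cons]

variable {n : ℕ} {π σ : SetPartition n} {i j k l : Fin n}

/-- Two points lie in the same class of `π`. -/
def SameClass (π : SetPartition n) (i j : Fin n) : Prop := ∃ B ∈ π.parts, i ∈ B ∧ j ∈ B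

lemma sameClass_iff : SameClass π i j ↔ j ∈ π.part i := by
  constructor
  · rintro ⟨B, hB, hi, hj⟩
    rwa [π.part_eq_of_mem hB hi]
  · intro h
    exact ⟨π.part i, π.part_mem.2 (Finset.mem_univ _), π.mem_part (Finset.mem_univ _), h⟩

lemma SameClass.refl (π : SetPartition n) (i : Fin n) : SameClass π i i :=
  sameClass_iff.2 (π.mem_part (Finset.mem_univ _))

lemma SameClass.symm (h : SameClass π i j) : SameClass π j i :=
  let ⟨B, hB, hi, hj⟩ := h; ⟨B, hB, hj, hi⟩

lemma SameClass.trans (h : SameClass π i j) (h' : SameClass π j k) : SameClass π i k := by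
  obtain ⟨B, hB, hi, hj⟩ := h
  obtain ⟨B', hB', hj', hk⟩ := h'
  obtain rfl := π.eq_of_mem_parts hB hB' hj hj'
  exact ⟨B, hB, hi, hk⟩

lemma SameClass.mem_of_mem (h : SameClass π i j) {B : Finset (Fin n)} (hB : B ∈ π.parts)
    (hi : i ∈ B) : j ∈ B := by
  obtain ⟨B', hB', hi', hj⟩ := h
  rwa [π.eq_of_mem_parts hB hB' hi hi']

lemma eq_of_sameClass_imp (h : ∀ i j, SameClass π i j ↔ SameClass σ i j) : π = σ := by
  have key : ∀ {π σ : SetPartition n}, (∀ i j, SameClass π i j ↔ SameClass σ i j) →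
      ∀ B ∈ π.parts, B ∈ σ.parts := by
    intro π σ h B hB
    obtain ⟨i, hi⟩ := π.nonempty_of_mem_parts hB
    have : B = σ.part i := by
      ext j
      rw [← sameClass_iff, ← h, sameClass_iff, π.part_eq_of_mem hB hi]
    rw [this]
    exact σ.part_mem.2 (Finset.mem_univ _)
  ext B
  exact ⟨key h B, key (fun i j => (h i j).symm) B⟩

lemma IsNext.lt (h : IsNext π i k) : i < k := h.1.1

lemma IsNext.sameClass (h : IsNext π i k) : SameClass π i k := h.1.2

lemma IsNext.le (h : IsNext π i k) (hij : i < j) (hs : SameClass π i j) : k ≤ j := h.2 ⟨hij, hs⟩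

lemma IsNext.left_unique (h : IsNext π i k) (h' : IsNext π j k) : i = j := by
  by_contra hne
  have hs : SameClass π i j := h.sameClass.trans h'.sameClass.symm
  rcases lt_or_gt_of_ne hne with hij | hij
  · exact absurd (h.le hij hs) h'.lt.not_ge
  · exact absurd (h'.le hij hs.symm) h.lt.not_ge

lemma SameClass.exists_next (h : SameClass π i j) (hij : i < j) : ∃ k, IsNext π i k := by
  classical
  let s : Finset (Fin n) := Finset.univ.filter fun r => i < r ∧ SameClass π i r
  have hs : s.Nonempty := ⟨j, by simp [s, hij, h]⟩
  have := s.isLeast_min' hs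
  refine ⟨s.min' hs, ?_⟩
  have hcoe : (s : Set (Fin n)) = {r | i < r ∧ SameClass π i r} := by simp [s]
  rwa [hcoe] at this

lemma SameClass.exists_prev (h : SameClass π i j) (hij : i < j) :
    ∃ l, i ≤ l ∧ IsNext π l j := by
  classical
  let s : Finset (Fin n) := Finset.univ.filter fun r => r < j ∧ SameClass π r j
  have hi : i ∈ s := by simp [s, hij, h]
  have hs : s.Nonempty := ⟨i, hi⟩
  have hmax := s.max'_mem hs
  simp only [s, Finset.mem_filter, Finset.mem_univ, true_and] at hmax
  refine ⟨s.max' hs, s.le_max' i hi, hmax, ?_⟩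
  rintro r ⟨hr, hrs⟩
  by_contra! hrj
  have hrs' : SameClass π r j := (SameClass.symm hrs).trans hmax.2
  exact absurd (s.le_max' r (by simp [s, hrj, hrs'])) hr.not_ge

open Classical in
/-- The arcs of a set partition: the pairs of a point and the next point of its class. -/
noncomputable def arcs (π : SetPartition n) : Finset (ℕ × ℕ) :=
  (Finset.univ.filter fun x : Fin n × Fin n => IsNext π x.1 x.2).image
    fun x => ((x.1 : ℕ), (x.2 : ℕ))

lemma mem_arcs {x : ℕ × ℕ} :
    x ∈ arcs π ↔ ∃ i k : Fin n, IsNext π i k ∧ ((i : ℕ), (k : ℕ)) = x := by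
  simp [arcs]

lemma coe_mem_arcs : ((i : ℕ), (k : ℕ)) ∈ arcs π ↔ IsNext π i k := by
  rw [mem_arcs]
  constructor
  · rintro ⟨i', k', h, he⟩
    simp only [Prod.mk.injEq, Fin.val_inj] at he
    obtain ⟨rfl, rfl⟩ := he
    exact h
  · exact fun h => ⟨i, k, h, rfl⟩

/-- Two points of a class are linked by a chain of arcs, followed here backwards from the larger
one. -/
lemma arcs_injective : Function.Injective (arcs (n := n)) := by
  have key : ∀ {π σ : SetPartition n}, (∀ i k, IsNext π i k → IsNext σ i k) →
      ∀ i j, SameClass π i j → SameClass σ i j := by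
    intro π σ h
    have hlt : ∀ j i, i < j → SameClass π i j → SameClass σ i j := by
      intro j
      induction j using WellFoundedLT.induction with
      | ind j ih =>
      intro i hij hs
      obtain ⟨l, hil, hl⟩ := hs.exists_prev hij
      rcases hil.eq_or_lt with rfl | hil
      · exact (h _ _ hl).sameClass
      · exact (ih l hl.lt i hil (hs.trans hl.sameClass.symm)).trans (h _ _ hl).sameClass
    intro i j hs
    rcases lt_trichotomy i j with hij | rfl | hij
    · exact hlt j i hij hs
    · exact SameClass.refl σ i
    · exact (hlt i j hij hs.symm).symm
  intro π σ h
  have hnext : ∀ i k, IsNext π i k ↔ IsNext σ i k := fun i k => by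
    rw [← coe_mem_arcs, h, coe_mem_arcs]
  exact eq_of_sameClass_imp fun i j =>
    ⟨key (fun i k => (hnext i k).1) i j, key (fun i k => (hnext i k).2) i j⟩

/-- The classes are the maximal chains of arcs. Since each point has at most one outgoing and one
incoming arc, being joined by a chain in one direction or the other is transitive. -/
lemma exists_arcs_eq {b : ℕ → ℕ} {A : Finset (ℕ × ℕ)} (hA : IsCompletion b n 0 ∅ A) :
    ∃ π : SetPartition n, arcs π = A := by
  classical
  let R : Fin n → Fin n → Prop := fun i k => ((i : ℕ), (k : ℕ)) ∈ A
  have hlt : ∀ {i k}, R i k → i < k := fun h => (hA.bounds h).2.2.1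
  have hle : ∀ {i k}, Relation.ReflTransGen R i k → i ≤ k := by
    intro i k h
    induction h with
    | refl => exact le_rfl
    | tail _ h ih => exact ih.trans (hlt h).le
  have hR : Relator.RightUnique R := fun i k l hk hl => Fin.ext (hA.right_unique hk hl)
  have hL : Relator.RightUnique (Function.swap R) :=
    fun k i j hi hj => Fin.ext (hA.left_unique hi hj)
  let s : Setoid (Fin n) :=
    { r := fun i j => Relation.ReflTransGen R i j ∨ Relation.ReflTransGen R j i
      iseqv :=
        { refl := fun i => Or.inl .refl
          symm := fun h => h.symm
          trans := by
            rintro i j k (h1 | h1) (h2 | h2)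
            · exact Or.inl (h1.trans h2)
            · rw [← Relation.reflTransGen_swap] at h1 h2
              have := Relation.ReflTransGen.total_of_right_unique hL h1 h2
              exact this.symm.imp Relation.reflTransGen_swap.1 Relation.reflTransGen_swap.1
            · exact Relation.ReflTransGen.total_of_right_unique hR h1 h2
            · exact Or.inr (h2.trans h1) } }
  let π : SetPartition n := Finpartition.ofSetoid s
  have hsame : ∀ {i j}, i < j → (SameClass π i j ↔ Relation.ReflTransGen R i j) := by
    intro i j hij
    rw [sameClass_iff, Finpartition.mem_part_ofSetoid_iff_rel]
    exact ⟨fun h => h.resolve_right fun h => absurd (hle h) hij.not_ge, Or.inl⟩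
  have hnext : ∀ i k, IsNext π i k ↔ R i k := by
    intro i k
    constructor
    · intro h
      rcases ((hsame h.lt).1 h.sameClass).cases_head with rfl | ⟨k', h1, h2⟩
      · exact absurd h.lt (lt_irrefl _)
      · have := h.le (hlt h1) ((hsame (hlt h1)).2 (.single h1))
        rwa [le_antisymm this (hle h2)]
    · intro h
      refine ⟨⟨hlt h, (hsame (hlt h)).2 (.single h)⟩, ?_⟩
      rintro r ⟨hir, hr⟩
      rcases ((hsame hir).1 hr).cases_head with rfl | ⟨k', h1, h2⟩
      · exact absurd hir (lt_irrefl _)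
      · rw [hR h h1]; exact hle h2
  refine ⟨π, ?_⟩
  ext ⟨i, k⟩
  constructor
  · intro h
    obtain ⟨i', k', h, he⟩ := mem_arcs.1 h
    exact he ▸ (hnext i' k').1 h
  · intro h
    obtain ⟨-, hk, hik, -⟩ := hA.bounds h
    exact coe_mem_arcs.2 ((hnext ⟨i, hik.trans hk⟩ ⟨k, hk⟩).2 h)

lemma numSingletons_eq_zero_iff : numSingletons π = 0 ↔ ∀ B ∈ π.parts, B.card ≠ 1 := by
  simp [numSingletons, Finset.filter_eq_empty_iff]

/-- Blocks are intervals, so if a class has two points in one block, the arc ending at the larger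
one already lies inside that block. Testing arcs is therefore enough. -/
lemma isCompletion_arcs_iff {ns : List ℕ} {π : SetPartition ns.sum} :
    IsCompletion (blockIndex ns) ns.sum 0 ∅ (arcs π) ↔
      Inhomogeneous ns π ∧ numSingletons π = 0 := by
  rw [numSingletons_eq_zero_iff]
  constructor
  · intro h
    constructor
    · have hlt : ∀ i j : Fin ns.sum, i < j → SameClass π i j →
          blockIndex ns i ≠ blockIndex ns j := by
        intro i j hij hs
        obtain ⟨l, hil, hl⟩ := hs.exists_prev hij
        have h1 := (h.bounds (coe_mem_arcs.2 hl)).2.2.2.1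
        have h2 : blockIndex ns i ≤ blockIndex ns l := blockIndex_mono ns hil
        have h3 : blockIndex ns l ≤ blockIndex ns j := blockIndex_mono ns hl.lt.le
        omega
      intro B hB i hi j hj hij
      rcases lt_or_gt_of_ne hij with hij | hij
      · exact hlt i j hij ⟨B, hB, hi, hj⟩
      · exact (hlt j i hij ⟨B, hB, hj, hi⟩).symm
    · intro B hB hcard
      obtain ⟨k, rfl⟩ := Finset.card_eq_one.1 hcard
      rcases h.not_isolated (Nat.zero_le k) k.2 with ⟨i, hi⟩ | ⟨l, hl⟩
      · obtain ⟨i', k', hik, he⟩ := mem_arcs.1 hi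
        simp only [Prod.mk.injEq, Fin.val_inj] at he
        obtain ⟨-, rfl⟩ := he
        have := hik.sameClass.symm.mem_of_mem hB (Finset.mem_singleton_self _)
        exact hik.lt.ne (Finset.mem_singleton.1 this)
      · obtain ⟨k', l', hkl, he⟩ := mem_arcs.1 hl
        simp only [Prod.mk.injEq, Fin.val_inj] at he
        obtain ⟨rfl, -⟩ := he
        have := hkl.sameClass.mem_of_mem hB (Finset.mem_singleton_self _)
        exact hkl.lt.ne' (Finset.mem_singleton.1 this)
  · rintro ⟨hinh, hsing⟩
    refine ⟨fun {i k} h => ?_, fun {i k l} hk hl => ?_, fun {i j k} hi hj => ?_, by simp,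
      fun {k} _ hk => ?_⟩
    · obtain ⟨i', k', hik, he⟩ := mem_arcs.1 h
      simp only [Prod.mk.injEq] at he
      obtain ⟨rfl, rfl⟩ := he
      obtain ⟨B, hB, hi, hk⟩ := hik.sameClass
      exact ⟨Nat.zero_le _, k'.2, hik.lt, hinh B hB _ hi _ hk hik.lt.ne, Or.inr (Nat.zero_le _)⟩
    · obtain ⟨i₁, k', h1, he1⟩ := mem_arcs.1 hk
      obtain ⟨i₂, l', h2, he2⟩ := mem_arcs.1 hl
      simp only [Prod.mk.injEq] at he1 he2
      obtain ⟨rfl, rfl⟩ := he1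
      obtain ⟨he, rfl⟩ := he2
      obtain rfl := Fin.val_inj.1 he
      rw [h1.unique h2]
    · obtain ⟨i', k₁, h1, he1⟩ := mem_arcs.1 hi
      obtain ⟨j', k₂, h2, he2⟩ := mem_arcs.1 hj
      simp only [Prod.mk.injEq] at he1 he2
      obtain ⟨rfl, rfl⟩ := he1
      obtain ⟨rfl, he⟩ := he2
      obtain rfl := Fin.val_inj.1 he
      rw [h1.left_unique h2]
    · let k' : Fin ns.sum := ⟨k, hk⟩
      have hB := π.part_mem.2 (Finset.mem_univ k')
      have hkB := π.mem_part (Finset.mem_univ k')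
      have hex : ∃ j ∈ π.part k', j ≠ k' := by
        by_contra! hall
        exact hsing _ hB (Finset.card_eq_one.2
          ⟨k', Finset.eq_singleton_iff_unique_mem.2 ⟨hkB, hall⟩⟩)
      obtain ⟨j, hj, hjk⟩ := hex
      have hs : SameClass π k' j := sameClass_iff.2 hj
      rcases lt_or_gt_of_ne hjk with hjk | hjk
      · obtain ⟨l, -, hl⟩ := hs.symm.exists_prev hjk
        exact Or.inl ⟨l, coe_mem_arcs.2 hl⟩
      · obtain ⟨l, hl⟩ := hs.exists_next hjk
        exact Or.inr ⟨l, coe_mem_arcs.2 hl⟩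

lemma restrictedCrossings_eq_arcCrossings : restrictedCrossings π = arcCrossings (arcs π) := by
  let f : Fin n × Fin n × Fin n × Fin n → (ℕ × ℕ) × (ℕ × ℕ) :=
    fun x => ((x.1, x.2.2.1), (x.2.1, x.2.2.2))
  have hf : Function.Injective f := by
    rintro ⟨i, j, k, l⟩ ⟨i', j', k', l'⟩ h
    simp only [f, Prod.mk.injEq, Fin.val_inj] at h ⊢
    tauto
  rw [restrictedCrossings, ← Set.ncard_image_of_injective _ hf, arcCrossings,
    ← Set.ncard_coe_finset]
  congr 1
  ext ⟨⟨i, k⟩, ⟨j, l⟩⟩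
  simp only [Set.mem_image, Set.mem_ofPred_eq, Finset.coe_filter, Finset.mem_product]
  constructor
  · rintro ⟨⟨i', j', k', l'⟩, ⟨h1, h2, h3, h4, h5⟩, he⟩
    simp only [f, Prod.mk.injEq] at he
    obtain ⟨⟨rfl, rfl⟩, rfl, rfl⟩ := he
    exact ⟨⟨coe_mem_arcs.2 h4, coe_mem_arcs.2 h5⟩, h1, h2, h3⟩
  · rintro ⟨⟨hik, hjl⟩, h1, h2, h3⟩
    obtain ⟨i', k', h4, he⟩ := mem_arcs.1 hik
    obtain ⟨j', l', h5, he'⟩ := mem_arcs.1 hjl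
    simp only [Prod.mk.injEq] at he he'
    obtain ⟨rfl, rfl⟩ := he
    obtain ⟨rfl, rfl⟩ := he'
    exact ⟨(i', j', k', l'), ⟨h1, h2, h3, h4, h5⟩, rfl⟩

/-- The points at which no arc ends are the least elements of the classes. -/
lemma card_parts_eq_card_openers : π.parts.card = (openers n 0 (arcs π)).card := by
  have hmin (B) (hB : B ∈ π.parts) := B.min'_mem (π.nonempty_of_mem_parts hB)
  refine Finset.card_bij (fun B hB => ((B.min' (π.nonempty_of_mem_parts hB) : Fin n) : ℕ))
    ?_ ?_ ?_
  · intro B hB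
    simp only [openers, Finset.mem_filter, Finset.mem_Ico, Nat.zero_le, true_and, Fin.is_lt]
    rintro ⟨i, k⟩ hik (rfl : k = _)
    obtain ⟨i', k', h, he⟩ := mem_arcs.1 hik
    simp only [Prod.mk.injEq, Fin.val_inj] at he
    obtain ⟨-, rfl⟩ := he
    exact absurd (B.min'_le _ (h.sameClass.symm.mem_of_mem hB (hmin B hB))) h.lt.not_ge
  · intro B hB B' hB' h
    exact π.eq_of_mem_parts hB hB' (hmin B hB) (Fin.val_inj.1 h ▸ hmin B' hB')
  · intro k hk
    simp only [openers, Finset.mem_filter, Finset.mem_Ico, Nat.zero_le, true_and] at hk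
    obtain ⟨hk, hne⟩ := hk
    let k' : Fin n := ⟨k, hk⟩
    have hB := π.part_mem.2 (Finset.mem_univ k')
    refine ⟨π.part k', hB, ?_⟩
    have hle := (π.part k').min'_le k' (π.mem_part (Finset.mem_univ k'))
    rcases hle.eq_or_lt with h | h
    · rw [h]
    · have hs : SameClass π _ k' := (sameClass_iff.2 (hmin _ hB)).symm
      obtain ⟨l, -, hl⟩ := hs.exists_prev h
      exact absurd rfl (hne _ (coe_mem_arcs.2 hl))

lemma mem_inhomogeneousNoSingletons {ns : List ℕ} {π : SetPartition ns.sum} :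
    π ∈ inhomogeneousNoSingletons ns ↔ Inhomogeneous ns π ∧ numSingletons π = 0 := by
  simp [inhomogeneousNoSingletons]

/-- The generating function of the inhomogeneous partitions without singletons is a vacuum
expectation of a product of transfer operators. -/
theorem sum_inhomogeneousNoSingletons (q t : ℝ) (ns : List ℕ) :
    ∑ π ∈ inhomogeneousNoSingletons ns, q ^ restrictedCrossings π * t ^ π.parts.card =
      transfer q t ns 0 := by
  rw [← completionSum_blockIndex, completionSum]
  refine Finset.sum_bij (fun π _ => arcs π) ?_ (fun π _ σ _ h => arcs_injective h) ?_ ?_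
  · intro π hπ
    rw [mem_completions, isCompletion_arcs_iff]
    exact mem_inhomogeneousNoSingletons.1 hπ
  · intro A hA
    rw [mem_completions] at hA
    obtain ⟨π, rfl⟩ := exists_arcs_eq hA
    exact ⟨π, mem_inhomogeneousNoSingletons.2 (isCompletion_arcs_iff.1 hA), rfl⟩
  · intro π _
    rw [arcWeight, restrictedCrossings_eq_arcCrossings, card_parts_eq_card_openers]

/-- The `m` points of the last block lie in distinct classes. This makes the exponent `|π| - m` a
genuine subtraction. -/
lemma le_card_parts {ns : List ℕ} {m : ℕ} {π : SetPartition (ns ++ [m]).sum}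
    (hπ : Inhomogeneous (ns ++ [m]) π) : m ≤ π.parts.card := by
  have hlt : ∀ j : Fin m, ns.sum + j < (ns ++ [m]).sum := fun j => by simp
  have := Finset.card_le_card_of_injOn (s := (Finset.univ : Finset (Fin m))) (t := π.parts)
    (fun j => π.part ⟨ns.sum + j, hlt j⟩) (fun j _ => π.part_mem.2 (Finset.mem_univ _)) ?_
  · simpa using this
  · intro i _ j _ h
    by_contra hne
    refine hπ _ (π.part_mem.2 (Finset.mem_univ _)) ⟨ns.sum + i, hlt i⟩
      (π.mem_part (Finset.mem_univ _)) ⟨ns.sum + j, hlt j⟩ ?_ ?_ ?_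
    · simp only at h
      rw [h]
      exact π.mem_part (Finset.mem_univ _)
    · simpa [Fin.ext_iff] using hne
    · simp only [blockIndex_append_singleton ns m i.2, blockIndex_append_singleton ns m j.2]

end

/-! ### Existence of an orthogonality measure -/

/-- The spectral measure of a bounded self-adjoint operator at a unit vector. -/
lemma exists_spectralMeasure {H : Type*} [NormedAddCommGroup H] [InnerProductSpace ℂ H]
    [CompleteSpace H] {J : H →L[ℂ] H} (hJ : IsSelfAdjoint J) {v : H} (hv : ‖v‖ = 1) :
    ∃ μ : Measure ℝ, IsProbabilityMeasure μ ∧ ∀ p : ℝ[X],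
      Integrable (fun x => p.eval x) μ ∧
        ∫ x, p.eval x ∂μ = (inner ℂ v (aeval J p v)).re := by
  let K := spectrum ℝ J
  have : CompactSpace K := isCompact_iff_compactSpace.1 (spectrum.isCompact J)
  let φ : CompactlySupportedContinuousMap K ℝ →ₗ[ℝ] ℝ :=
    { toFun := fun f => (inner ℂ v (cfcHom hJ (f : C(K, ℝ)) v)).re
      map_add' := fun f g => by
        have : ((f + g : CompactlySupportedContinuousMap K ℝ) : C(K, ℝ)) = (f : C(K, ℝ)) + g := rfl
        rw [this, map_add, add_apply, inner_add_right, Complex.add_re]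
      map_smul' := fun r f => by
        have : ((r • f : CompactlySupportedContinuousMap K ℝ) : C(K, ℝ)) = r • (f : C(K, ℝ)) := rfl
        rw [this, map_smul, smul_apply, inner_smul_right_eq_smul]
        simp }
  have hφ : ∀ f, 0 ≤ f → 0 ≤ φ f := by
    intro f hf
    -- Positivity: with `f = g* g`, the functional is the squared norm of `g(J) v`.
    let g : C(K, ℝ) := ⟨fun x => √(f x), by fun_prop⟩
    have hfg : (f : C(K, ℝ)) = star g * g := by
      ext x
      simp [g, Real.mul_self_sqrt (show 0 ≤ f x from hf x)]
    change 0 ≤ (inner ℂ v (cfcHom hJ (f : C(K, ℝ)) v)).re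
    rw [hfg, map_mul, map_star, mul_apply_eq_comp, ContinuousLinearMap.star_eq_adjoint,
      ContinuousLinearMap.adjoint_inner_right]
    exact inner_self_nonneg (𝕜 := ℂ)
  let Λ := PositiveLinearMap.mk₀ φ hφ
  let ν := RealRMK.rieszMeasure Λ
  have hν : ∀ f : C(K, ℝ), ∫ x, f x ∂ν = (inner ℂ v (cfcHom hJ f v)).re := fun f =>
    RealRMK.integral_rieszMeasure Λ (CompactlySupportedContinuousMap.continuousMapEquiv f)
  have hpoly : ∀ p : ℝ[X], cfcHom hJ (p.toContinuousMapOn K) = aeval J p := by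
    intro p
    rw [← cfc_polynomial p J hJ, cfc_apply p.eval J hJ p.continuous.continuousOn]
    rfl
  have hemb : MeasurableEmbedding (Subtype.val : K → ℝ) :=
    MeasurableEmbedding.subtype_coe (spectrum.isClosed J).measurableSet
  have hint : ∀ p : ℝ[X], ∫ x, p.eval x ∂(ν.map Subtype.val) =
      (inner ℂ v (aeval J p v)).re := by
    intro p
    rw [hemb.integral_map, ← hpoly, ← hν]
    rfl
  refine ⟨ν.map Subtype.val, ?_, fun p => ⟨?_, hint p⟩⟩
  · have h1 := hint 1
    simp only [eval_one, map_one, one_apply_eq_self, integral_const, smul_eq_mul,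
      mul_one, inner_self_eq_norm_sq_to_K, hv] at h1
    constructor
    have h2 : (ν.map Subtype.val).real Set.univ = 1 := by simpa using h1
    rw [measureReal_def] at h2
    rw [← ENNReal.toReal_eq_one_iff]
    exact h2
  · rw [hemb.integrable_map_iff]
    exact ((p.continuous.comp continuous_subtype_val).integrable_of_hasCompactSupport
      (HasCompactSupport.of_compactSpace _))

/-- The Hilbert space of square-summable complex sequences. -/
noncomputable abbrev SquareSummable := lp (fun _ : ℕ => ℂ) 2

/-- Covers both the diagonal operator (`σ = id`) and the weighted backward shift (`σ n = n + 1`). -/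
lemma exists_weighted_comp {w : ℕ → ℂ} {K : ℝ} (hw : ∀ n, ‖w n‖ ≤ K) {σ : ℕ → ℕ}
    (hσ : Function.Injective σ) :
    ∃ T : SquareSummable →L[ℂ] SquareSummable, ∀ f n, T f n = w n * f (σ n) := by
  have hK : 0 ≤ K := (norm_nonneg _).trans (hw 0)
  have h2 : (0 : ℝ) < (2 : ENNReal).toReal := by norm_num
  have hle : ∀ (f : SquareSummable) n,
      ‖w n * f (σ n)‖ ^ (2 : ENNReal).toReal ≤ K ^ 2 * ‖f (σ n)‖ ^ 2 := by
    intro f n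
    rw [ENNReal.toReal_ofNat, Real.rpow_ofNat, norm_mul, mul_pow]
    gcongr
    exact hw n
  have hsum : ∀ f : SquareSummable, Summable fun n => ‖f n‖ ^ 2 := fun f => by
    simpa using (lp.memℓp f).summable h2
  have hsum' : ∀ f : SquareSummable, Summable fun n => K ^ 2 * ‖f (σ n)‖ ^ 2 := fun f =>
    ((hsum f).comp_injective hσ).mul_left _
  have hnorm : ∀ f : SquareSummable, ‖f‖ ^ 2 = ∑' n, ‖f n‖ ^ 2 := fun f => by
    simpa using lp.norm_rpow_eq_tsum h2 f
  have hmem : ∀ f : SquareSummable, Memℓp (fun n => w n * f (σ n)) 2 := fun f =>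
    memℓp_gen (Summable.of_nonneg_of_le (fun n => by positivity) (hle f) (hsum' f))
  let T : SquareSummable →ₗ[ℂ] SquareSummable :=
    { toFun := fun f => ⟨fun n => w n * f (σ n), hmem f⟩
      map_add' := fun f g => by ext n; exact mul_add _ _ _
      map_smul' := fun c f => by ext n; exact mul_left_comm _ _ _ }
  refine ⟨T.mkContinuous K fun f => ?_, fun f n => rfl⟩
  refine lp.norm_le_of_tsum_le h2 (by positivity) ?_
  calc ∑' n, ‖T f n‖ ^ (2 : ENNReal).toReal
      ≤ ∑' n, K ^ 2 * ‖f (σ n)‖ ^ 2 :=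
        Summable.tsum_le_tsum (hle f)
          (Summable.of_nonneg_of_le (fun n => by positivity) (hle f) (hsum' f)) (hsum' f)
    _ = K ^ 2 * ∑' n, ‖f (σ n)‖ ^ 2 := tsum_mul_left
    _ ≤ K ^ 2 * ∑' n, ‖f n‖ ^ 2 := by
        refine mul_le_mul_of_nonneg_left ?_ (by positivity)
        exact tsum_comp_le_tsum_of_inj (hsum f) (fun n => by positivity) hσ
    _ = (K * ‖f‖) ^ (2 : ENNReal).toReal := by rw [← hnorm]; simp [mul_pow]

/-- Bounded Jacobi matrices define self-adjoint operators. -/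
lemma exists_jacobi_operator {a b : ℕ → ℝ} {K : ℝ} (ha : ∀ n, |a n| ≤ K) (hb : ∀ n, |b n| ≤ K) :
    ∃ J : SquareSummable →L[ℂ] SquareSummable, IsSelfAdjoint J ∧ ∀ n,
      J (lp.single 2 n 1) = a n • lp.single 2 (n + 1) 1 + b n • lp.single 2 n 1 +
        (if n = 0 then 0 else a (n - 1) • lp.single 2 (n - 1) 1) := by
  obtain ⟨D, hD⟩ := exists_weighted_comp (w := fun n => ((b n / 2 : ℝ) : ℂ)) (K := K)
    (fun n => by
      rw [Complex.norm_real, Real.norm_eq_abs, abs_div, abs_two]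
      have := abs_nonneg (b n)
      have := hb n
      linarith) Function.injective_id
  obtain ⟨S, hS⟩ := exists_weighted_comp (w := fun n => ((a n : ℝ) : ℂ)) (K := K)
    (fun n => by rw [Complex.norm_real]; exact ha n) (add_left_injective 1)
  -- `D` carries half of the diagonal, as adding the adjoint doubles it; the adjoint of `S` is the
  -- raising part.
  refine ⟨(D + S) + ContinuousLinearMap.adjoint (D + S), ?_, fun n => ?_⟩
  · rw [← ContinuousLinearMap.star_eq_adjoint]
    exact IsSelfAdjoint.add_star_self _
  · ext m
    have hadj : ContinuousLinearMap.adjoint (D + S) (lp.single 2 n 1) m =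
        star ((D + S) (lp.single 2 m 1) n) := by
      have h1 := lp.inner_single_left (𝕜 := ℂ) (G := fun _ : ℕ => ℂ) m 1
        (ContinuousLinearMap.adjoint (D + S) (lp.single 2 n 1))
      rw [ContinuousLinearMap.adjoint_inner_right, lp.inner_single_right] at h1
      simpa using h1.symm
    rw [add_apply, lp.coeFn_add, Pi.add_apply, hadj]
    simp only [add_apply, lp.coeFn_add, Pi.add_apply, hD, hS, id,
      lp.single_apply]
    rcases n with _ | n
    · rcases m with _ | _ | m <;> simp
    · rcases lt_trichotomy m (n + 1) with h | rfl | h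
      · rcases eq_or_ne m n with rfl | hmn
        · simp [show m ≠ m + 1 + 1 by omega]
        · simp [h.ne, h.ne', hmn, show m ≠ n + 2 by omega, show n + 1 + 1 ≠ m by omega]
      · simp
      · rcases eq_or_ne m (n + 2) with rfl | hmn
        · simp
        · simp [h.ne, h.ne', hmn, hmn.symm, show m ≠ n by omega]

/-- **Favard's theorem** for `bigQHermite q t`: the spectral measure of an operator with the right
Jacobi matrix is a measure of orthogonality. -/
lemma exists_isOrthogonalityMeasure_of_operator {H : Type*} [NormedAddCommGroup H]
    [InnerProductSpace ℂ H] [CompleteSpace H] {q t : ℝ} {a : ℕ → ℝ}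
    (ha : ∀ n, a n * a n = t * qInt q (n + 1)) {J : H →L[ℂ] H} (hJ : IsSelfAdjoint J)
    {e : ℕ → H} (he : Orthonormal ℂ e)
    (hJe : ∀ n, J (e n) = a n • e (n + 1) + qInt q n • e n +
      (if n = 0 then 0 else a (n - 1) • e (n - 1))) :
    ∃ μ : Measure ℝ, IsOrthogonalityMeasure q t μ := by
  -- Applied to `e 0`, the polynomials give multiples of distinct orthonormal vectors, whence their
  -- orthogonality.
  have hC : ∀ m, aeval J (bigQHermite q t m) (e 0) = (∏ i ∈ Finset.range m, a i) • e m := by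
    intro m
    induction m using Nat.strong_induction_on with
    | _ m ih =>
    cases m with
    | zero => simp [bigQHermite]
    | succ m =>
      rw [bigQHermite_succ]
      simp only [map_sub, map_mul, aeval_X, aeval_C, mul_apply_eq_comp,
        sub_apply, sub_mul, Algebra.algebraMap_eq_smul_one, smul_apply, one_apply_eq_self]
      rw [ih m (by omega), ih (m - 1) (by omega), ContinuousLinearMap.map_smul_of_tower, hJe,
        Finset.prod_range_succ]
      cases m with
      | zero => simp
      | succ m =>
        rw [if_neg (Nat.succ_ne_zero m), Nat.add_sub_cancel, Finset.prod_range_succ, smul_smul t,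
          ← ha]
        module
  obtain ⟨μ, hμ, h⟩ := exists_spectralMeasure hJ (he.1 0)
  refine ⟨μ, hμ, fun p => (h p).1, fun m n hmn => ?_⟩
  have := (h (bigQHermite q t m * bigQHermite q t n)).2
  simp only [eval_mul] at this
  have hself : IsSelfAdjoint (aeval J (bigQHermite q t m)) := by
    rw [← cfc_polynomial _ J hJ]
    exact cfc_predicate _ J
  rw [this, map_mul, mul_apply_eq_comp, ← ContinuousLinearMap.adjoint_inner_left,
    ← ContinuousLinearMap.star_eq_adjoint, hself.star_eq, hC, hC, inner_smul_left_eq_star_smul,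
    inner_smul_right_eq_smul, he.2 hmn]
  simp

theorem exists_isOrthogonalityMeasure {q t : ℝ} (hq : -1 < q) (hq1 : q < 1) (ht : 0 < t) :
    ∃ μ : Measure ℝ, IsOrthogonalityMeasure q t μ := by
  obtain ⟨J, hJ, hJe⟩ := exists_jacobi_operator (a := fun n => √(t * qInt q (n + 1)))
    (b := qInt q) (K := max (√(t * (2 / (1 - q)))) (2 / (1 - q)))
    (fun n => by
      rw [abs_of_nonneg (Real.sqrt_nonneg _)]
      exact le_max_of_le_left (Real.sqrt_le_sqrt (by gcongr; exact qInt_le hq hq1 _)))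
    (fun n => by
      rw [abs_of_nonneg (qInt_nonneg hq hq1 n)]
      exact le_max_of_le_right (qInt_le hq hq1 n))
  refine exists_isOrthogonalityMeasure_of_operator
    (fun n => Real.mul_self_sqrt (mul_nonneg ht.le (qInt_nonneg hq hq1 _))) hJ ?_ hJe
  refine ⟨fun n => by simp, fun m n hmn => ?_⟩
  dsimp only
  rw [lp.inner_single_left, lp.single_apply_ne _ _ _ hmn, inner_zero_right]

end BigQHermite

open BigQHermite in
theorem mainTheorem1 (q t : ℝ) (hq : -1 < q) (hq1 : q < 1) (ht : 0 < t) :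
    (∃ μ : Measure ℝ, IsOrthogonalityMeasure q t μ) ∧
    (∀ μ : Measure ℝ, IsOrthogonalityMeasure q t μ → ∀ ns : List ℕ,
      ∫ x, (ns.map fun n => (bigQHermite q t n).eval x).prod ∂μ =
        ∑ π ∈ inhomogeneousNoSingletons ns, q ^ restrictedCrossings π * t ^ π.parts.card) ∧
    (∀ ns : List ℕ,
      (ns.map (bigQHermite q t)).prod =
        ∑ m ∈ Finset.range (ns.sum + 1),
          C (1 / qFact q m *
            ∑ π ∈ inhomogeneousNoSingletons (ns ++ [m]),
              q ^ restrictedCrossings π * t ^ (π.parts.card - m)) * bigQHermite q t m) := by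
  refine ⟨exists_isOrthogonalityMeasure hq hq1 ht, fun μ hμ ns => ?_, fun ns => ?_⟩
  · rw [sum_inhomogeneousNoSingletons, transfer_eq_aeval, ← integral_eval_eq hμ]
    simp only [eval_list_prod, List.map_map, Function.comp_def]
  · refine (eq_sum_bigQHermite hq hq1 t _ (natDegree_prod_bigQHermite_le q t ns)).trans
      (Finset.sum_congr rfl fun m _ => ?_)
    have hsum : t ^ m * ∑ π ∈ inhomogeneousNoSingletons (ns ++ [m]),
        q ^ restrictedCrossings π * t ^ (π.parts.card - m) = t ^ m * transfer q t ns m := by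
      rw [← transfer_append_singleton, ← sum_inhomogeneousNoSingletons, Finset.mul_sum]
      refine Finset.sum_congr rfl fun π hπ => ?_
      rw [mul_left_comm, pow_mul_pow_sub t (le_card_parts (mem_inhomogeneousNoSingletons.1 hπ).1)]
    -- The factor `t^m` of the last block cancels because `t ≠ 0`.
    rw [mul_left_cancel₀ (pow_ne_zero m ht.ne') hsum, ← transfer_eq_aeval, div_eq_inv_mul,
      one_div]
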